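/- A noncommutative probability space $(\mathcal A,\tau)$ is a complex associative unital $*$-algebra $\mathcal A$ with a unital tracial positive linear functional $\tau$; $L^2(\tau)$ is the Hilbert space completion of $\mathcal A$ for $\langle a,b\rangle=\tau(a^*b)$, and for $\xi\in L^2(\tau)$, $a\in\mathcal A$ one writes $\tau(\xi a):=\langle a^*,\xi\rangle$. For $X\in\mathcal A$ and a unital subalgebra $B\subseteq\mathcal A$, the free score $J(X:B)$ (if it exists) is the unique element of the $L^2(\tau)$-closure of the algebra $\mathrm{Alg}(X,B)$ generated by $X$ and $B$ such that $$\tau\bigl(J(X:B)\,P(X,Y_1,\dots,Y_n)\bigr)=(\tau\otimes\tau)\bigl(\partial P(X,Y_1,\dots,Y_n)\bigr)$$ for all $Y_1,\dots,Y_n\in B$ and all noncommutative polynomials $P$ in $n+1$ variables, where $\partial$ is the free difference quotient: $\partial X=1\otimes1$, $\partial Y_i=0$, $\partial(PQ)=(P\otimes 1)\,\partial Q+\partial P\,(1\otimes Q)$. Let $k\ge1$ be real and let $p\in\mathcal A$ satisfy $p=p^*=p^2$ and $\tau(p)=1/k$. Let $\mathcal A_p=p\mathcal Ap$, a unital $*$-algebra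 with unit $p$, let $\tau_p(x)=k\,\tau(x)$ for $x\in\mathcal A_p$, and let $\pi:\mathcal A\to\mathcal A_p$, $\pi(a)=pap$; the map $\pi$ extends continuously to $\pi:L^2(\tau)\to L^2(\tau_p)$. **Proposition (Free score and minors).** Let $X\in\mathcal A$ be self-adjoint and let $B$ be a unital $*$-subalgebra of $\mathcal A$. Assume that $\mathrm{Alg}(X,B)$ is freely independent of $p$ (that is, of the unital algebra generated by $p$), and that the free score $J(X:B)$ exists. Then the free score $J(\pi(X):\pi(B))$ in $(\mathcal A_p,\tau_p)$ exists (where $\pi(B)$ stands for the unital subalgebra of $\mathcal A_p$ that it generates), and $$J(\pi(X):\pi(B))=k\,\mathbb E\bigl(\pi(J(X:B))\,\big|\,\pi(X),\pi(B)\bigr),$$ where $\mathbb E(\cdot\,|\,\pi(X),\pi(B))$ is the orthogonal projection in $L^2(\tau_p)$ onto the closure of the subalgebra of $\mathcal A_p$ generated by $\pi(X)$ and $\pi(B)$. -/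

import Mathlib

open scoped ComplexOrder TensorProduct

set_option linter.unusedSectionVars false

namespace FreeProb

noncomputable section

/-! ### Noncommutative probability spaces -/

/-- A tracial state: a unital positive tracial linear functional on a complex unital `*`-algebra.
A noncommutative probability space is a complex unital `*`-algebra with such a functional (no
faithfulness is required, and the algebra carries no norm). -/
structure TracialState (A : Type*) [Ring A] [StarRing A] [Algebra ℂ A] where
  /-- the underlying linear functional -/
  toLinearMap : A →ₗ[ℂ] ℂ
  map_one : toLinearMap 1 = 1
  nonneg : ∀ a, 0 ≤ toLinearMap (star a * a)
  map_mul_comm : ∀ a b, toLinearMap (a * b) = toLinearMap (b * a)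

section Basic

variable {A : Type*} [Ring A] [StarRing A] [Algebra ℂ A] [StarModule ℂ A]

instance : CoeFun (TracialState A) (fun _ => A → ℂ) := ⟨fun τ => τ.toLinearMap⟩

theorem TracialState.map_star (τ : TracialState A) (a : A) :
    τ (star a) = (starRingEnd ℂ) (τ a) := by
  have h1 := (Complex.nonneg_iff.mp (τ.nonneg a)).2
  have h2 := (Complex.nonneg_iff.mp (τ.nonneg (1 + a))).2
  have h3 := (Complex.nonneg_iff.mp (τ.nonneg (1 + Complex.I • a))).2
  simp only [star_add, star_one, star_smul, add_mul, mul_add, one_mul, mul_one, map_add,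
    smul_mul_assoc, mul_smul_comm, map_smul, τ.map_one, smul_eq_mul, Complex.add_im,
    Complex.one_im, Complex.mul_im, Complex.I_re, Complex.I_im, Complex.star_def,
    Complex.conj_re, Complex.conj_im, Complex.mul_re] at h1 h2 h3
  apply Complex.ext
  · rw [Complex.conj_re]; linarith
  · rw [Complex.conj_im]; linarith

/-! ### The Hilbert space `L²(τ)` -/

set_option linter.unusedVariables false in
/-- The algebra `A`, seen as a semi-inner product space for `⟪a, b⟫ = τ (a* b)`. -/
@[nolint unusedArguments]
def PreL2 (τ : TracialState A) : Type _ := A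

instance (τ : TracialState A) : AddCommGroup (PreL2 τ) := inferInstanceAs (AddCommGroup A)
instance (τ : TracialState A) : Module ℂ (PreL2 τ) := inferInstanceAs (Module ℂ A)

/-- The identity map from `A` to `PreL2 τ`. -/
def toPreL2 (τ : TracialState A) : A ≃ₗ[ℂ] PreL2 τ := LinearEquiv.refl ℂ A

/-- The semi-inner product `⟪a, b⟫ = τ (a* b)`. -/
abbrev preL2Core (τ : TracialState A) : PreInnerProductSpace.Core ℂ (PreL2 τ) where
  inner a b := τ (star ((toPreL2 τ).symm a) * (toPreL2 τ).symm b)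
  conj_inner_symm a b := by rw [← τ.map_star]; simp
  re_inner_nonneg a := (Complex.nonneg_iff.mp (τ.nonneg _)).1
  add_left a b c := by simp [add_mul]
  smul_left a b r := by simp

instance (τ : TracialState A) : SeminormedAddCommGroup (PreL2 τ) :=
  InnerProductSpace.Core.toSeminormedAddCommGroup (c := preL2Core τ)
instance (τ : TracialState A) : InnerProductSpace ℂ (PreL2 τ) :=
  InnerProductSpace.ofCore (preL2Core τ)

theorem preL2_inner (τ : TracialState A) (a b : A) :
    inner ℂ (toPreL2 τ a) (toPreL2 τ b) = τ (star a * b) := rfl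

/-- The Hilbert space `L²(τ)`: the (separated) completion of `A` for `⟪a, b⟫ = τ (a* b)`. -/
abbrev L2 (τ : TracialState A) : Type _ := UniformSpace.Completion (PreL2 τ)

/-- The canonical map `A → L²(τ)`. -/
def toL2 (τ : TracialState A) : A →ₗ[ℂ] L2 τ :=
  (UniformSpace.Completion.toComplL (𝕜 := ℂ) (E := PreL2 τ)).toLinearMap ∘ₗ
    (toPreL2 τ).toLinearMap

theorem toL2_inner (τ : TracialState A) (a b : A) :
    inner ℂ (toL2 τ a) (toL2 τ b) = τ (star a * b) :=
  UniformSpace.Completion.inner_coe _ _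

/-- The number `τ (ξ a)` for `ξ ∈ L²(τ)` and `a ∈ A`, that is `⟪a*, ξ⟫`. -/
def traceMul (τ : TracialState A) (ξ : L2 τ) (a : A) : ℂ := inner ℂ (toL2 τ (star a)) ξ

theorem traceMul_toL2 (τ : TracialState A) (b a : A) : traceMul τ (toL2 τ b) a = τ (b * a) := by
  rw [traceMul, toL2_inner, star_star, τ.map_mul_comm]

/-- The closure in `L²(τ)` of (the image of) a subalgebra. -/
def l2Closure (τ : TracialState A) (S : Subalgebra ℂ A) : Submodule ℂ (L2 τ) :=
  ((Subalgebra.toSubmodule S).map (toL2 τ)).topologicalClosure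

instance (τ : TracialState A) (S : Subalgebra ℂ A) : CompleteSpace (l2Closure τ S) :=
  (Submodule.isClosed_topologicalClosure _).completeSpace_coe

/-- The conditional expectation `𝔼(ξ | S)`: the orthogonal projection of `L²(τ)` onto the closure
of the subalgebra `S`. -/
def condExp (τ : TracialState A) (S : Subalgebra ℂ A) : L2 τ →L[ℂ] L2 τ :=
  (l2Closure τ S).starProjection

/-! ### Free independence -/

/-- Free independence of a family of unital subalgebras: `τ (a₁ ⋯ aₙ) = 0` for `n ≥ 1` whenever
every `aⱼ` is a trace-zero element of `S iⱼ` and neighbouring indices `iⱼ`, `iⱼ₊₁` are different.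
The list consists of the pairs `(iⱼ, aⱼ)`. -/
def FreelyIndependent (τ : TracialState A) {ι : Type*} (S : ι → Subalgebra ℂ A) : Prop :=
  ∀ l : List (ι × A), l ≠ [] → l.IsChain (fun x y => x.1 ≠ y.1) →
    (∀ x ∈ l, x.2 ∈ S x.1 ∧ τ x.2 = 0) → τ (l.map Prod.snd).prod = 0

/-! ### The free difference quotient and the free score -/

/-- `Alg(X, B)`, the unital algebra generated by `X` and `B`. -/
def algGen (X : A) (B : Subalgebra ℂ A) : Subalgebra ℂ A :=
  Algebra.adjoin ℂ (insert X (B : Set A))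

/-- Noncommutative polynomials in one formal variable (the letter `none`) and in formal letters
`some Y`, one for each `Y ∈ B`. -/
abbrev NCPoly (B : Subalgebra ℂ A) : Type _ := FreeAlgebra ℂ (Option B)

/-- The value `P(X, Y₁, …, Yₙ)` of a noncommutative polynomial: the formal variable becomes `X` and
the letter of `Y ∈ B` becomes `Y`. -/
def evalPoly (X : A) (B : Subalgebra ℂ A) : NCPoly B →ₐ[ℂ] A :=
  FreeAlgebra.lift ℂ (fun o => o.elim X (fun Y => (Y : A)))

/-- The homomorphism `P ↦ [[P ⊗ 1, ∂P], [0, 1 ⊗ P]]` into upper triangular matrices over `A ⊗ A`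
determined by `∂X = 1 ⊗ 1` and `∂Y = 0` for `Y ∈ B`. -/
def diffQuotMatrix (X : A) (B : Subalgebra ℂ A) :
    NCPoly B →ₐ[ℂ] Matrix (Fin 2) (Fin 2) (A ⊗[ℂ] A) :=
  FreeAlgebra.lift ℂ (fun o => o.elim
    !![X ⊗ₜ[ℂ] 1, 1 ⊗ₜ[ℂ] 1; 0, 1 ⊗ₜ[ℂ] X]
    (fun Y => !![(Y : A) ⊗ₜ[ℂ] 1, 0; 0, 1 ⊗ₜ[ℂ] (Y : A)]))

/-- The free difference quotient `∂P(X, Y₁, …, Yₙ) ∈ A ⊗ A`. It is characterized by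
`diffQuot_var`, `diffQuot_coeff` and the Leibniz rule `diffQuot_mul`. -/
def diffQuot (X : A) (B : Subalgebra ℂ A) : NCPoly B →ₗ[ℂ] A ⊗[ℂ] A where
  toFun P := diffQuotMatrix X B P 0 1
  map_add' P Q := by simp
  map_smul' c P := by simp

theorem diffQuotMatrix_diag (X : A) (B : Subalgebra ℂ A) (P : NCPoly B) :
    diffQuotMatrix X B P 0 0 = evalPoly X B P ⊗ₜ[ℂ] 1 ∧
      diffQuotMatrix X B P 1 0 = 0 ∧
      diffQuotMatrix X B P 1 1 = 1 ⊗ₜ[ℂ] evalPoly X B P := by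
  induction P using FreeAlgebra.induction with
  | grade0 r =>
    simp [Algebra.algebraMap_eq_smul_one, Algebra.TensorProduct.one_def, TensorProduct.smul_tmul']
  | grade1 o => cases o <;> simp [diffQuotMatrix, evalPoly]
  | mul P Q hP hQ =>
    obtain ⟨h1, h2, h3⟩ := hP
    obtain ⟨h4, h5, h6⟩ := hQ
    simp [Matrix.mul_apply, Fin.sum_univ_two, h1, h2, h3, h4, h5, h6]
  | add P Q hP hQ =>
    obtain ⟨h1, h2, h3⟩ := hP
    obtain ⟨h4, h5, h6⟩ := hQ
    simp [h1, h2, h3, h4, h5, h6, TensorProduct.add_tmul, TensorProduct.tmul_add]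

theorem diffQuot_var (X : A) (B : Subalgebra ℂ A) :
    diffQuot X B (FreeAlgebra.ι ℂ none) = 1 ⊗ₜ[ℂ] 1 := by
  simp [diffQuot, diffQuotMatrix]

theorem diffQuot_coeff (X : A) (B : Subalgebra ℂ A) (Y : B) :
    diffQuot X B (FreeAlgebra.ι ℂ (some Y)) = 0 := by
  simp [diffQuot, diffQuotMatrix]

/-- The Leibniz rule `∂(PQ) = (P ⊗ 1) ∂Q + ∂P (1 ⊗ Q)`. -/
theorem diffQuot_mul (X : A) (B : Subalgebra ℂ A) (P Q : NCPoly B) :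
    diffQuot X B (P * Q) = (evalPoly X B P ⊗ₜ[ℂ] 1) * diffQuot X B Q +
      diffQuot X B P * (1 ⊗ₜ[ℂ] evalPoly X B Q) := by
  simp [diffQuot, Matrix.mul_apply, Fin.sum_univ_two, (diffQuotMatrix_diag X B P).1,
    (diffQuotMatrix_diag X B Q).2.2]

/-- The functional `τ ⊗ τ` on `A ⊗ A`. -/
def tensorTrace (τ : TracialState A) : A ⊗[ℂ] A →ₗ[ℂ] ℂ :=
  LinearMap.mul' ℂ ℂ ∘ₗ TensorProduct.map τ.toLinearMap τ.toLinearMap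

/-- `J` is a free score (conjugate variable) of `X` relative to `B`: it lies in the `L²(τ)` closure
of `Alg(X, B)`, and `τ (J P) = (τ ⊗ τ)(∂P)` for every noncommutative polynomial
`P = P(X, Y₁, …, Yₙ)` with `Y₁, …, Yₙ ∈ B`. -/
def IsFreeScore (τ : TracialState A) (X : A) (B : Subalgebra ℂ A) (J : L2 τ) : Prop :=
  J ∈ l2Closure τ (algGen X B) ∧
    ∀ P : NCPoly B, traceMul τ J (evalPoly X B P) = tensorTrace τ (diffQuot X B P)

/-! ### Compression by a projection -/

/-- The algebra `A_p = pAp`, whose unit is `p`. -/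
def Compressed {p : A} (hp : IsStarProjection p) : Type _ := hp.isIdempotentElem.Corner

instance {p : A} (hp : IsStarProjection p) : Ring (Compressed hp) :=
  inferInstanceAs (Ring hp.isIdempotentElem.Corner)

/-- The minor map `π(a) = [p a p]`, as a bare function. -/
def minorFun {p : A} (hp : IsStarProjection p) (a : A) : Compressed hp := ⟨p * a * p, a, rfl⟩

/-- The element of `A` that underlies an element of `A_p = pAp`. -/
def Compressed.val {p : A} {hp : IsStarProjection p} (x : Compressed hp) : A := Subtype.val x

section Compressed

variable {p : A} {hp : IsStarProjection p}

theorem Compressed.ext {x y : Compressed hp} (h : x.val = y.val) : x = y := Subtype.ext h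

@[simp] theorem minorFun_val (a : A) : (minorFun hp a).val = p * a * p := rfl
@[simp] theorem Compressed.val_one : (1 : Compressed hp).val = p := rfl
@[simp] theorem Compressed.val_zero : (0 : Compressed hp).val = 0 := rfl
@[simp] theorem Compressed.val_add (x y : Compressed hp) : (x + y).val = x.val + y.val := rfl
@[simp] theorem Compressed.val_mul (x y : Compressed hp) : (x * y).val = x.val * y.val := rfl

theorem Compressed.p_mul (x : Compressed hp) : p * x.val = x.val :=
  ((Subsemigroup.mem_corner_iff hp.isIdempotentElem).mp x.2).1
theorem Compressed.mul_p (x : Compressed hp) : x.val * p = x.val :=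
  ((Subsemigroup.mem_corner_iff hp.isIdempotentElem).mp x.2).2

theorem minorFun_eq_of_val (x : Compressed hp) : minorFun hp x.val = x :=
  Compressed.ext (by rw [minorFun_val, x.p_mul, x.mul_p])

instance : SMul ℂ (Compressed hp) := ⟨fun c x => minorFun hp (c • x.val)⟩

@[simp] theorem Compressed.val_smul (c : ℂ) (x : Compressed hp) : (c • x).val = c • x.val := by
  change p * (c • x.val) * p = c • x.val
  rw [mul_smul_comm, smul_mul_assoc, x.p_mul, x.mul_p]

instance : Module ℂ (Compressed hp) where
  one_smul x := Compressed.ext (by simp)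
  mul_smul c d x := Compressed.ext (by simp [mul_smul])
  smul_zero c := Compressed.ext (by simp)
  smul_add c x y := Compressed.ext (by simp)
  add_smul c d x := Compressed.ext (by simp [add_smul])
  zero_smul x := Compressed.ext (by simp)

instance : Algebra ℂ (Compressed hp) :=
  Algebra.ofModule (fun c x y => Compressed.ext (by simp)) (fun c x y => Compressed.ext (by simp))

instance : Star (Compressed hp) := ⟨fun x => minorFun hp (star x.val)⟩

@[simp] theorem Compressed.val_star (x : Compressed hp) : (star x).val = star x.val := by
  change p * star x.val * p = star x.val
  nth_rw 1 [← hp.isSelfAdjoint.star_eq]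
  rw [← star_mul, x.mul_p]
  nth_rw 2 [← hp.isSelfAdjoint.star_eq]
  rw [← star_mul, x.p_mul]

instance : StarRing (Compressed hp) where
  star_involutive x := Compressed.ext (by simp)
  star_mul x y := Compressed.ext (by simp)
  star_add x y := Compressed.ext (by simp)

instance : StarModule ℂ (Compressed hp) where
  star_smul c x := Compressed.ext (by simp)

end Compressed

/-- The minor map (compression map) `π : A → A_p`, `π(a) = [p a p]`. -/
def minor {p : A} (hp : IsStarProjection p) : A →ₗ[ℂ] Compressed hp where
  toFun := minorFun hp
  map_add' a b := Compressed.ext (by simp [mul_add, add_mul])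
  map_smul' c a := Compressed.ext (by simp)

theorem minor_val {p : A} (hp : IsStarProjection p) (a : A) : (minor hp a).val = p * a * p := rfl

/-- The trace `τ_p([p a p]) = k τ(p a p)` on `A_p`, for a projection `p` of trace `1/k`. -/
def compressedTrace (τ : TracialState A) {p : A} (hp : IsStarProjection p) {k : ℝ} (hk : 1 ≤ k)
    (hτp : τ p = ((k⁻¹ : ℝ) : ℂ)) : TracialState (Compressed hp) where
  toLinearMap :=
    { toFun := fun x => (k : ℂ) * τ x.val
      map_add' := fun x y => by simp [mul_add]
      map_smul' := fun c x => by simp; ring }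
  map_one := by
    have : (k : ℂ) ≠ 0 := by
      exact_mod_cast (show k ≠ 0 by linarith)
    simp [hτp, this]
  nonneg x := by
    have h1 : (0 : ℂ) ≤ (k : ℂ) := by
      exact_mod_cast (show (0 : ℝ) ≤ k by linarith)
    have h2 := τ.nonneg x.val
    simpa using mul_nonneg h1 h2
  map_mul_comm x y := by
    simp [τ.map_mul_comm x.val y.val]

theorem compressedTrace_apply (τ : TracialState A) {p : A} (hp : IsStarProjection p) {k : ℝ}
    (hk : 1 ≤ k) (hτp : τ p = ((k⁻¹ : ℝ) : ℂ)) (x : Compressed hp) :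
    compressedTrace τ hp hk hτp x = (k : ℂ) * τ x.val := rfl

theorem re_le_of_isStarProjection (τ : TracialState A) {p : A} (hp : IsStarProjection p) (a : A) :
    (τ (star a * p * a)).re ≤ (τ (star a * a)).re := by
  have h := (Complex.nonneg_iff.mp (τ.nonneg ((1 - p) * a))).1
  have e : star ((1 - p) * a) * ((1 - p) * a) = star a * a - star a * p * a := by
    have h1 : (1 - p) * (1 - p) = 1 - p := hp.isIdempotentElem.one_sub.eq
    rw [star_mul, star_sub, star_one, hp.isSelfAdjoint.star_eq, mul_assoc, ← mul_assoc (1 - p), h1]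
    noncomm_ring
  rw [e, map_sub, Complex.sub_re] at h
  linarith

/-- The minor map is bounded from `L²(τ)` to `L²(τ_p)`. -/
theorem norm_minor_le (τ : TracialState A) {p : A} (hp : IsStarProjection p) {k : ℝ} (hk : 1 ≤ k)
    (hτp : τ p = ((k⁻¹ : ℝ) : ℂ)) (a : A) :
    ‖toPreL2 (compressedTrace τ hp hk hτp) (minor hp a)‖ ≤ √k * ‖toPreL2 τ a‖ := by
  have hn : ∀ {A' : Type _} [Ring A'] [StarRing A'] [Algebra ℂ A'] [StarModule ℂ A']
      (σ : TracialState A') (b : A'), ‖toPreL2 σ b‖ = √(σ (star b * b)).re := fun _ _ => rfl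
  rw [hn, hn, ← Real.sqrt_mul (by linarith)]
  apply Real.sqrt_le_sqrt
  rw [compressedTrace_apply, Complex.re_ofReal_mul]
  apply mul_le_mul_of_nonneg_left _ (by linarith)
  rw [Compressed.val_mul, Compressed.val_star, minor_val]
  have hs := hp.isSelfAdjoint.star_eq
  have hi := hp.isIdempotentElem.eq
  have e1 : star (p * a * p) * (p * a * p) = star (a * p) * p * (a * p) := by
    simp only [star_mul, hs]
    simp only [mul_assoc]
    rw [← mul_assoc p p (a * p), hi]
  have e2 : τ (star (a * p) * (a * p)) = τ (star (star a) * p * star a) := by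
    rw [τ.map_mul_comm]
    simp only [star_mul, hs, star_star, mul_assoc]
    rw [← mul_assoc p p, hi]
  calc (τ (star (p * a * p) * (p * a * p))).re
      ≤ (τ (star (a * p) * (a * p))).re := by
        rw [e1]; exact re_le_of_isStarProjection τ hp (a * p)
    _ ≤ (τ (star (star a) * star a)).re := by
        rw [e2]; exact re_le_of_isStarProjection τ hp (star a)
    _ = (τ (star a * a)).re := by rw [star_star, τ.map_mul_comm]

/-- The continuous extension `π : L²(τ) → L²(τ_p)` of the minor map. -/
def minorL2 (τ : TracialState A) {p : A} (hp : IsStarProjection p) {k : ℝ} (hk : 1 ≤ k)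
    (hτp : τ p = ((k⁻¹ : ℝ) : ℂ)) : L2 τ →L[ℂ] L2 (compressedTrace τ hp hk hτp) :=
  (LinearMap.mkContinuous
    ((toPreL2 (compressedTrace τ hp hk hτp)).toLinearMap ∘ₗ minor hp ∘ₗ
      (toPreL2 τ).symm.toLinearMap) (√k)
    (fun a => norm_minor_le τ hp hk hτp ((toPreL2 τ).symm a))).completion

theorem minorL2_toL2 (τ : TracialState A) {p : A} (hp : IsStarProjection p) {k : ℝ} (hk : 1 ≤ k)
    (hτp : τ p = ((k⁻¹ : ℝ) : ℂ)) (a : A) :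
    minorL2 τ hp hk hτp (toL2 τ a) = toL2 (compressedTrace τ hp hk hτp) (minor hp a) :=
  ContinuousLinearMap.completion_apply_coe _ _

end Basic

end

end FreeProb

open FreeProb

/-!
The proposition splits into a statement about free independence inside `A` and a change of
variables from `A` to `A_p`.

**Free extension of the coefficients.** Adding `p` to the coefficients does not change the free
score: `τ(J a) = (τ ⊗ τ)(∂a)` still holds for polynomials `a` in `X`, `B` and `p`, with `∂p = 0`
(`IsFreeScore.traceMul_of_free`). Since `τ` need not be faithful, `∂` is not a function on the
algebra, so the argument works with the relation `DiffPair` between an element and a derivative of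
it. Put `q = p - 1/k`, which is centred and satisfies a quadratic equation. By that equation and by
centring, every polynomial is a combination of words `m₀ q m₁ q ⋯ q mₙ` with `mⱼ ∈ Alg(X, B)` and
centred inner letters (`DiffPair.mem_wordSpan_of_insert`). For `n = 0` the identity is the assumption
on `J`. For `n ≥ 1` both sides vanish. On the left, `J` is a limit of elements `d ∈ Alg(X, B)`, and
freeness gives `τ(d m₀ q ⋯ q mₙ) = 0` (`TailWord.traceMul_eq_zero`). On the right, each term of `∂`
splits the word inside some letter `mⱼ`, hence leaves a factor `q` in at least one of the legs, and
the trace of such a leg is zero (`TailWord.trace_mul`, `TailWord.tensorTrace_mul`).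

**Compression.** Since `∂(p X p) = p ⊗ p` is the unit of `A_p ⊗ A_p`, the difference quotient of
`A_p` is the one above, restricted to `A_p` (`diffPair_val_diffQuot`). The trace `τ_p` carries one
factor `k` and `τ_p ⊗ τ_p` carries two, which explains the factor `k` in the formula. The projection
does not change the pairing with elements of the generated algebra, as this algebra is closed under
`*` (`traceMul_condExp`). Uniqueness holds as a free score is determined by its inner products with
a dense subspace (`IsFreeScore.unique`).
-/

namespace FreeProb

noncomputable section

/-! ### The Leibniz rule as a relation -/

section Pairs

variable {A : Type*} [Ring A] [StarRing A] [Algebra ℂ A] [StarModule ℂ A]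

/-- Left multiplication by `(a, δ)` on `A × (A ⊗ A)`, for the product
`(a, δ) (b, ε) = (ab, δ (1 ⊗ b) + (a ⊗ 1) ε)` that encodes the Leibniz rule. -/
def pairMul (x : A × (A ⊗[ℂ] A)) : A × (A ⊗[ℂ] A) →ₗ[ℂ] A × (A ⊗[ℂ] A) where
  toFun y := (x.1 * y.1, x.2 * (1 ⊗ₜ[ℂ] y.1) + (x.1 ⊗ₜ[ℂ] 1) * y.2)
  map_add' y z := by
    ext1
    · simp [mul_add]
    · simp only [Prod.fst_add, Prod.snd_add, TensorProduct.tmul_add, mul_add]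
      abel
  map_smul' c y := by
    ext1 <;> simp [TensorProduct.tmul_smul]

theorem pairMul_apply (x y : A × (A ⊗[ℂ] A)) :
    pairMul x y = (x.1 * y.1, x.2 * (1 ⊗ₜ[ℂ] y.1) + (x.1 ⊗ₜ[ℂ] 1) * y.2) := rfl

theorem pairMul_assoc (x y z : A × (A ⊗[ℂ] A)) :
    pairMul (pairMul x y) z = pairMul x (pairMul y z) := by
  have h1 : ∀ a b : A, (1 : A) ⊗ₜ[ℂ] (a * b) = (1 ⊗ₜ a) * (1 ⊗ₜ b) := by simp
  have h2 : ∀ a b : A, (a * b) ⊗ₜ[ℂ] (1 : A) = (a ⊗ₜ 1) * (b ⊗ₜ 1) := by simp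
  ext1
  · simp [pairMul_apply, mul_assoc]
  · simp only [pairMul_apply, h1, h2, add_mul, mul_add, mul_assoc, add_assoc]

theorem pairMul_add_left (x y z : A × (A ⊗[ℂ] A)) :
    pairMul (x + y) z = pairMul x z + pairMul y z := by
  ext1
  · simp [pairMul_apply, add_mul]
  · simp only [pairMul_apply, Prod.fst_add, Prod.snd_add, TensorProduct.add_tmul, add_mul]
    abel

theorem pairMul_smul_left (c : ℂ) (x z : A × (A ⊗[ℂ] A)) :
    pairMul (c • x) z = c • pairMul x z := by
  ext1
  · simp [pairMul_apply]
  · simp only [pairMul_apply, Prod.smul_fst, Prod.smul_snd, ← TensorProduct.smul_tmul',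
      smul_mul_assoc, smul_add]

theorem pairMul_one_left (z : A × (A ⊗[ℂ] A)) : pairMul (1, 0) z = z := by
  ext1 <;> simp [pairMul_apply, ← Algebra.TensorProduct.one_def]

theorem pairMul_one_right (z : A × (A ⊗[ℂ] A)) : pairMul z (1, 0) = z := by
  ext1 <;> simp [pairMul_apply, ← Algebra.TensorProduct.one_def]

/-- The pairs `(P, ∂P)`, where `P` is a value of a noncommutative polynomial in `X` and elements of
`S`, and `∂` is computed by the Leibniz rule from `∂X = 1 ⊗ 1` and `∂Y = 0` for `Y ∈ S`. This is a
relation rather than a function: `∂P` may depend on the way in which `P` is written. -/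
inductive DiffPair (X : A) (S : Set A) : A × (A ⊗[ℂ] A) → Prop
  | coeff {y : A} : y ∈ S → DiffPair X S (y, 0)
  | var : DiffPair X S (X, 1 ⊗ₜ[ℂ] 1)
  | add {x y : A × (A ⊗[ℂ] A)} : DiffPair X S x → DiffPair X S y → DiffPair X S (x + y)
  | mul {x y : A × (A ⊗[ℂ] A)} : DiffPair X S x → DiffPair X S y → DiffPair X S (pairMul x y)

theorem DiffPair.mem_algGen {X : A} {B : Subalgebra ℂ A} {x : A × (A ⊗[ℂ] A)}
    (h : DiffPair X B x) : x.1 ∈ algGen X B := by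
  induction h with
  | coeff hy => exact Algebra.subset_adjoin (Or.inr hy)
  | var => exact Algebra.subset_adjoin (Or.inl rfl)
  | add _ _ h1 h2 => exact add_mem h1 h2
  | mul _ _ h1 h2 => exact mul_mem h1 h2

theorem DiffPair.smul {X : A} {S : Set A} (hS : ∀ c : ℂ, algebraMap ℂ A c ∈ S)
    {x : A × (A ⊗[ℂ] A)} (h : DiffPair X S x) (c : ℂ) : DiffPair X S (c • x) := by
  have := (DiffPair.coeff (X := X) (hS c)).mul h
  rwa [show ((algebraMap ℂ A c, 0) : A × (A ⊗[ℂ] A)) = c • (1, 0) by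
    simp [Algebra.algebraMap_eq_smul_one], pairMul_smul_left, pairMul_one_left] at this

theorem DiffPair.exists_poly {X : A} {B : Subalgebra ℂ A} {x : A × (A ⊗[ℂ] A)}
    (h : DiffPair X B x) : ∃ P : NCPoly B, (evalPoly X B P, diffQuot X B P) = x := by
  induction h with
  | coeff hy => exact ⟨FreeAlgebra.ι ℂ (some ⟨_, hy⟩), by simp [evalPoly, diffQuot_coeff]⟩
  | var => exact ⟨FreeAlgebra.ι ℂ none, by simp [evalPoly, diffQuot_var]⟩
  | add _ _ h1 h2 =>
    obtain ⟨P, rfl⟩ := h1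
    obtain ⟨Q, rfl⟩ := h2
    exact ⟨P + Q, by simp⟩
  | mul _ _ h1 h2 =>
    obtain ⟨P, rfl⟩ := h1
    obtain ⟨Q, rfl⟩ := h2
    exact ⟨P * Q, by rw [diffQuot_mul, map_mul, pairMul_apply, add_comm]⟩

/-- The span of the elementary tensors with both legs in `D`. -/
def tensorSpan (D : Subalgebra ℂ A) : Submodule ℂ (A ⊗[ℂ] A) :=
  Submodule.span ℂ {t | ∃ a ∈ D, ∃ b ∈ D, a ⊗ₜ[ℂ] b = t}

theorem mul_mem_tensorSpan {D : Subalgebra ℂ A} {s t : A ⊗[ℂ] A} (hs : s ∈ tensorSpan D)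
    (ht : t ∈ tensorSpan D) : s * t ∈ tensorSpan D := by
  have := Submodule.mul_mem_mul hs ht
  rw [tensorSpan, Submodule.span_mul_span] at this
  refine Submodule.span_mono ?_ this
  rintro _ ⟨_, ⟨a, ha, b, hb, rfl⟩, _, ⟨c, hc, d, hd, rfl⟩, rfl⟩
  exact ⟨a * c, mul_mem ha hc, b * d, mul_mem hb hd, by simp⟩

theorem tmul_mem_tensorSpan {D : Subalgebra ℂ A} {a b : A} (ha : a ∈ D) (hb : b ∈ D) :
    a ⊗ₜ[ℂ] b ∈ tensorSpan D := Submodule.subset_span ⟨a, ha, b, hb, rfl⟩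

theorem DiffPair.mem_tensorSpan {X : A} {B : Subalgebra ℂ A} {x : A × (A ⊗[ℂ] A)}
    (h : DiffPair X B x) : x.2 ∈ tensorSpan (algGen X B) := by
  induction h with
  | coeff hy => exact zero_mem _
  | var => exact tmul_mem_tensorSpan (one_mem _) (one_mem _)
  | add _ _ h1 h2 => exact add_mem h1 h2
  | mul h h' h1 h2 =>
    exact add_mem (mul_mem_tensorSpan h1 (tmul_mem_tensorSpan (one_mem _) h'.mem_algGen))
      (mul_mem_tensorSpan (tmul_mem_tensorSpan h.mem_algGen (one_mem _)) h2)

theorem tensorTrace_tmul (τ : TracialState A) (a b : A) :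
    tensorTrace τ (a ⊗ₜ[ℂ] b) = τ a * τ b := by
  simp [tensorTrace]

/-- `(τ ⊗ τ)((u ⊗ 1) δ (1 ⊗ v))` vanishes for `δ ∈ D ⊗ D` if one of its two legs does. -/
theorem tensorTrace_mul_eq_zero (τ : TracialState A) {D : Subalgebra ℂ A} {δ : A ⊗[ℂ] A}
    (hδ : δ ∈ tensorSpan D) {u v : A}
    (h : (∀ a ∈ D, τ (u * a) = 0) ∨ ∀ b ∈ D, τ (b * v) = 0) :
    tensorTrace τ ((u ⊗ₜ[ℂ] 1) * δ * (1 ⊗ₜ[ℂ] v)) = 0 := by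
  induction hδ using Submodule.span_induction with
  | mem x hx =>
    obtain ⟨a, ha, b, hb, rfl⟩ := hx
    rw [Algebra.TensorProduct.tmul_mul_tmul, Algebra.TensorProduct.tmul_mul_tmul, mul_one,
      one_mul, tensorTrace_tmul]
    rcases h with h | h
    · rw [h a ha, zero_mul]
    · rw [h b hb, mul_zero]
  | zero => simp
  | add x y _ _ hx hy => rw [mul_add, add_mul, map_add, hx, hy, add_zero]
  | smul c x _ hx => rw [mul_smul_comm, smul_mul_assoc, map_smul, hx, smul_zero]

end Pairs

/-! ### Centred words in two free subalgebras -/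

section Freeness

variable {A : Type*} [Ring A] [StarRing A] [Algebra ℂ A] [StarModule ℂ A]

/-- `u` is a product of centred elements, alternately from `D` and `C`, which is empty or ends with
an element of `D`. -/
def IsCenteredWord (τ : TracialState A) (D C : Subalgebra ℂ A) (u : A) : Prop :=
  ∃ l : List (Fin 2 × A), l.IsChain (fun x y => x.1 ≠ y.1) ∧
    (∀ x ∈ l, x.2 ∈ (![D, C] : Fin 2 → Subalgebra ℂ A) x.1 ∧ τ x.2 = 0) ∧
    (∀ x ∈ l.getLast?, x.1 = 0) ∧ (l.map Prod.snd).prod = u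

variable {τ : TracialState A} {D C : Subalgebra ℂ A}

theorem isCenteredWord_one : IsCenteredWord τ D C 1 := ⟨[], by simp⟩

theorem isCenteredWord_of_mem {d : A} (hd : d ∈ D) (h0 : τ d = 0) : IsCenteredWord τ D C d :=
  ⟨[(0, d)], by simp [hd, h0]⟩

theorem IsCenteredWord.exists_list_mul_mul {u q d : A} (hu : IsCenteredWord τ D C u) (hq : q ∈ C)
    (hq0 : τ q = 0) (hd : d ∈ D) (hd0 : τ d = 0) :
    ∃ l : List (Fin 2 × A), l ≠ [] ∧ l.IsChain (fun x y => x.1 ≠ y.1) ∧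
      (∀ x ∈ l, x.2 ∈ (![D, C] : Fin 2 → Subalgebra ℂ A) x.1 ∧ τ x.2 = 0) ∧
      (∀ x ∈ l.getLast?, x.1 = 0) ∧ (l.map Prod.snd).prod = u * q * d := by
  obtain ⟨l, h1, h2, h3, rfl⟩ := hu
  refine ⟨l ++ [(1, q), (0, d)], by simp, ?_, ?_, by simp, by simp [mul_assoc]⟩
  · rw [List.isChain_append]
    refine ⟨h1, by simp, ?_⟩
    intro x hx y hy
    simp only [List.head?_cons, Option.mem_def, Option.some.injEq] at hy
    rw [h3 x hx, ← hy]
    simp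
  · intro x hx
    rw [List.mem_append] at hx
    rcases hx with hx | hx
    · exact h2 x hx
    · simp only [List.mem_cons, List.not_mem_nil, or_false] at hx
      rcases hx with rfl | rfl
      · simp [hq, hq0]
      · simp [hd, hd0]

theorem IsCenteredWord.mul_mul {u q d : A} (hu : IsCenteredWord τ D C u) (hq : q ∈ C)
    (hq0 : τ q = 0) (hd : d ∈ D) (hd0 : τ d = 0) : IsCenteredWord τ D C (u * q * d) := by
  obtain ⟨l, -, h⟩ := hu.exists_list_mul_mul hq hq0 hd hd0
  exact ⟨l, h⟩

theorem IsCenteredWord.trace_mul {u q : A} (hfree : FreelyIndependent τ ![D, C])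
    (hu : IsCenteredWord τ D C u) (hq : q ∈ C) (hq0 : τ q = 0) : τ (u * q) = 0 := by
  obtain ⟨l, h1, h2, h3, rfl⟩ := hu
  have := hfree (l ++ [(1, q)]) (by simp) ?_ ?_
  · simpa using this
  · rw [List.isChain_append]
    refine ⟨h1, by simp, ?_⟩
    intro x hx y hy
    simp only [List.head?_cons, Option.mem_def, Option.some.injEq] at hy
    rw [h3 x hx, ← hy]
    simp
  · intro x hx
    rw [List.mem_append] at hx
    rcases hx with hx | hx
    · exact h2 x hx
    · simp only [List.mem_cons, List.not_mem_nil, or_false] at hx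
      subst hx
      simp [hq, hq0]

theorem sub_trace_mem (τ : TracialState A) {D : Subalgebra ℂ A} {d : A} (hd : d ∈ D) :
    d - τ d • (1 : A) ∈ D := sub_mem hd (D.smul_mem (one_mem _) _)

theorem trace_sub_trace (τ : TracialState A) (d : A) : τ (d - τ d • (1 : A)) = 0 := by
  simp [τ.map_one]

theorem IsCenteredWord.trace_mul_mul {u q d : A} (hfree : FreelyIndependent τ ![D, C])
    (hu : IsCenteredWord τ D C u) (hq : q ∈ C) (hq0 : τ q = 0) (hd : d ∈ D) :
    τ (u * q * d) = 0 := by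
  obtain ⟨l, h0, h1, h2, h3, h4⟩ :=
    hu.exists_list_mul_mul hq hq0 (sub_trace_mem τ hd) (trace_sub_trace τ d)
  have h5 : τ (u * q * (d - τ d • (1 : A))) = 0 := by
    rw [← h4]
    exact hfree l h0 h1 h2
  have h6 := hu.trace_mul hfree hq hq0
  rw [mul_sub, map_sub, mul_smul_comm, mul_one, map_smul, h6, smul_zero, sub_zero] at h5
  exact h5

/-- A linear map that kills the centred words kills `D`, since `d = (d - τ(d)) + τ(d)` is a
combination of a centred letter and the empty word. -/
theorem eq_zero_of_isCenteredWord {M : Type*} [AddCommGroup M] [Module ℂ M] (f : A →ₗ[ℂ] M)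
    (hf : ∀ u, IsCenteredWord τ D C u → f u = 0) {d : A} (hd : d ∈ D) : f d = 0 := by
  have h1 := hf _ (isCenteredWord_of_mem (C := C) (sub_trace_mem τ hd) (trace_sub_trace τ d))
  rwa [map_sub, map_smul, hf 1 isCenteredWord_one, smul_zero, sub_zero] at h1

end Freeness

/-! ### Free extension of the coefficient algebra -/

section Words

variable {A : Type*} [Ring A] [StarRing A] [Algebra ℂ A] [StarModule ℂ A]

/-- The words `q m₁ q m₂ ⋯ q mₙ` with `n ≥ 1`, with `mⱼ ∈ Alg(X, B)`, and with `mⱼ` centred for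
`j < n`, paired with their derivatives, where `∂q = 0`. -/
inductive TailWord (τ : TracialState A) (X : A) (B : Subalgebra ℂ A) (q : A) :
    A × (A ⊗[ℂ] A) → Prop
  | single {m : A × (A ⊗[ℂ] A)} : DiffPair X B m → TailWord τ X B q (pairMul (q, 0) m)
  | cons {m t : A × (A ⊗[ℂ] A)} : DiffPair X B m → τ m.1 = 0 → TailWord τ X B q t →
      TailWord τ X B q (pairMul (q, 0) (pairMul m t))

/-- The span of `Alg(X, B)` and of the words `m₀ q m₁ ⋯ q mₙ` with `n ≥ 1` and centred inner
letters `m₁, …, mₙ₋₁`, paired with their derivatives. -/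
def wordSpan (τ : TracialState A) (X : A) (B : Subalgebra ℂ A) (q : A) :
    Submodule ℂ (A × (A ⊗[ℂ] A)) :=
  Submodule.span ℂ {w | DiffPair X B w ∨ ∃ m t, DiffPair X B m ∧ TailWord τ X B q t ∧
    pairMul m t = w}

variable {τ : TracialState A} {X : A} {B : Subalgebra ℂ A} {q : A}

theorem DiffPair.mem_wordSpan {m : A × (A ⊗[ℂ] A)} (hm : DiffPair X B m) :
    m ∈ wordSpan τ X B q := Submodule.subset_span (Or.inl hm)

theorem diffPair_one : DiffPair X B (1, 0) := DiffPair.coeff B.one_mem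

theorem TailWord.pairMul_mem {m t : A × (A ⊗[ℂ] A)} (ht : TailWord τ X B q t)
    (hm : DiffPair X B m) : pairMul m t ∈ wordSpan τ X B q :=
  Submodule.subset_span (Or.inr ⟨m, t, hm, ht, rfl⟩)

theorem TailWord.mem_wordSpan {t : A × (A ⊗[ℂ] A)} (ht : TailWord τ X B q t) :
    t ∈ wordSpan τ X B q := by
  simpa only [pairMul_one_left] using ht.pairMul_mem diffPair_one

theorem pairMul_mem_wordSpan_of_diffPair {m w : A × (A ⊗[ℂ] A)} (hm : DiffPair X B m)
    (hw : w ∈ wordSpan τ X B q) : pairMul m w ∈ wordSpan τ X B q := by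
  induction hw using Submodule.span_induction with
  | mem w hw =>
    rcases hw with hw | ⟨n, t, hn, ht, rfl⟩
    · exact (hm.mul hw).mem_wordSpan
    · rw [← pairMul_assoc]
      exact ht.pairMul_mem (hm.mul hn)
  | zero => simp
  | add v w _ _ hv hw => rw [map_add]; exact add_mem hv hw
  | smul c w _ hw => rw [map_smul]; exact Submodule.smul_mem _ _ hw

theorem pairMul_q_q {α β : ℂ} (hq : q * q = α • q + β • 1) (w : A × (A ⊗[ℂ] A)) :
    pairMul (q, 0) (pairMul (q, 0) w) = α • pairMul (q, 0) w + β • w := by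
  rw [← pairMul_assoc, pairMul_apply (q, 0) (q, 0), hq,
    show ((α • q + β • 1, (0 : A ⊗[ℂ] A) * (1 ⊗ₜ[ℂ] q) + (q ⊗ₜ[ℂ] 1) * 0) : A × (A ⊗[ℂ] A)) =
      α • (q, 0) + β • (1, 0) by simp, pairMul_add_left, pairMul_smul_left, pairMul_smul_left,
    pairMul_one_left]

theorem TailWord.pairMul_q_mem {α β : ℂ} (hq : q * q = α • q + β • 1) {t : A × (A ⊗[ℂ] A)}
    (ht : TailWord τ X B q t) : pairMul (q, 0) t ∈ wordSpan τ X B q := by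
  cases ht with
  | single hm =>
    rw [pairMul_q_q hq]
    exact add_mem (Submodule.smul_mem _ _ (TailWord.single hm).mem_wordSpan)
      (Submodule.smul_mem _ _ hm.mem_wordSpan)
  | cons hm h0 ht =>
    rw [pairMul_q_q hq]
    exact add_mem (Submodule.smul_mem _ _ (TailWord.cons hm h0 ht).mem_wordSpan)
      (Submodule.smul_mem _ _ (ht.pairMul_mem hm))

theorem pairMul_q_mem_wordSpan {α β : ℂ} (hq : q * q = α • q + β • 1) {w : A × (A ⊗[ℂ] A)}
    (hw : w ∈ wordSpan τ X B q) : pairMul (q, 0) w ∈ wordSpan τ X B q := by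
  induction hw using Submodule.span_induction with
  | mem w hw =>
    rcases hw with hw | ⟨m, t, hm, ht, rfl⟩
    · exact (TailWord.single hw).mem_wordSpan
    · -- the letter `m`, now an inner one, is centred: `q m t = q (m - τ m) t + τ m q t`
      have hB : ∀ c : ℂ, algebraMap ℂ A c ∈ (B : Set A) := B.algebraMap_mem
      have hm' : DiffPair X B (m + (-τ m.1) • (1, 0)) := hm.add (diffPair_one.smul hB _)
      have h1 := (TailWord.cons hm' (by simp [τ.map_one]) ht).mem_wordSpan
      have h2 := add_mem h1 (Submodule.smul_mem _ (τ m.1) (ht.pairMul_q_mem hq))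
      rwa [pairMul_add_left, pairMul_smul_left, pairMul_one_left, map_add, map_smul,
        neg_smul, neg_add_cancel_right] at h2
  | zero => simp
  | add v w _ _ hv hw => rw [map_add]; exact add_mem hv hw
  | smul c w _ hw => rw [map_smul]; exact Submodule.smul_mem _ _ hw

theorem DiffPair.pairMul_mem_wordSpan {α β c : ℂ} (hq : q * q = α • q + β • 1)
    {x : A × (A ⊗[ℂ] A)} (hx : DiffPair X (insert (q + c • 1) (B : Set A)) x) :
    ∀ w ∈ wordSpan τ X B q, pairMul x w ∈ wordSpan τ X B q := by
  induction hx with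
  | coeff hy =>
    intro w hw
    rcases hy with rfl | hy
    · rw [show ((q + c • 1, 0) : A × (A ⊗[ℂ] A)) = (q, 0) + c • (1, 0) by simp,
        pairMul_add_left, pairMul_smul_left, pairMul_one_left]
      exact add_mem (pairMul_q_mem_wordSpan hq hw) (Submodule.smul_mem _ _ hw)
    · exact pairMul_mem_wordSpan_of_diffPair (.coeff hy) hw
  | var => exact fun w hw => pairMul_mem_wordSpan_of_diffPair .var hw
  | add _ _ h1 h2 =>
    intro w hw
    rw [pairMul_add_left]
    exact add_mem (h1 w hw) (h2 w hw)
  | mul _ _ h1 h2 =>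
    intro w hw
    rw [pairMul_assoc]
    exact h1 _ (h2 w hw)

theorem DiffPair.mem_wordSpan_of_insert {α β c : ℂ} (hq : q * q = α • q + β • 1)
    {x : A × (A ⊗[ℂ] A)} (hx : DiffPair X (insert (q + c • 1) (B : Set A)) x) :
    x ∈ wordSpan τ X B q := by
  simpa only [pairMul_one_right] using
    hx.pairMul_mem_wordSpan (τ := τ) hq (1, 0) diffPair_one.mem_wordSpan

/-- Multiplying a centred word by `q m₁ ⋯ q mₙ` prolongs it letter by letter until only the last,
not necessarily centred letter `mₙ` is left, so that freeness applies. -/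
theorem TailWord.trace_mul {C : Subalgebra ℂ A} (hfree : FreelyIndependent τ ![algGen X B, C])
    (hqC : q ∈ C) (hq0 : τ q = 0) {t : A × (A ⊗[ℂ] A)} (ht : TailWord τ X B q t) :
    ∀ u, IsCenteredWord τ (algGen X B) C u → τ (u * t.1) = 0 := by
  induction ht with
  | single hm =>
    intro u hu
    rw [pairMul_apply, ← mul_assoc]
    exact hu.trace_mul_mul hfree hqC hq0 hm.mem_algGen
  | cons hm h0 _ ih =>
    intro u hu
    simp only [pairMul_apply, ← mul_assoc]
    exact ih _ (hu.mul_mul hqC hq0 hm.mem_algGen h0)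

theorem TailWord.trace_mul_of_mem {C : Subalgebra ℂ A}
    (hfree : FreelyIndependent τ ![algGen X B, C]) (hqC : q ∈ C) (hq0 : τ q = 0)
    {t : A × (A ⊗[ℂ] A)} (ht : TailWord τ X B q t) {d : A} (hd : d ∈ algGen X B) :
    τ (d * t.1) = 0 :=
  eq_zero_of_isCenteredWord (τ := τ) (C := C) (τ.toLinearMap ∘ₗ LinearMap.mulRight ℂ t.1)
    (fun u hu => ht.trace_mul hfree hqC hq0 u hu) hd

/-- Every term of the derivative of `q m₁ ⋯ q mₙ`, multiplied by a centred word `u` from the left,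
has a left leg `u q m₁ ⋯ q a` with `a ∈ Alg(X, B)`, the trace of which is zero. -/
theorem TailWord.tensorTrace_mul {C : Subalgebra ℂ A}
    (hfree : FreelyIndependent τ ![algGen X B, C]) (hqC : q ∈ C) (hq0 : τ q = 0)
    {t : A × (A ⊗[ℂ] A)} (ht : TailWord τ X B q t) :
    ∀ u, IsCenteredWord τ (algGen X B) C u → tensorTrace τ ((u ⊗ₜ[ℂ] 1) * t.2) = 0 := by
  induction ht with
  | single hm =>
    intro u hu
    have := tensorTrace_mul_eq_zero τ hm.mem_tensorSpan (v := 1)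
      (Or.inl fun a ha => hu.trace_mul_mul hfree hqC hq0 ha)
    rw [← Algebra.TensorProduct.one_def, mul_one] at this
    simpa [pairMul_apply, ← mul_assoc] using this
  | @cons m t hm h0 ht ih =>
    intro u hu
    have h1 := tensorTrace_mul_eq_zero τ hm.mem_tensorSpan (v := t.1)
      (Or.inl fun a ha => hu.trace_mul_mul hfree hqC hq0 ha)
    have h2 := ih _ (hu.mul_mul hqC hq0 hm.mem_algGen h0)
    simp only [pairMul_apply, zero_mul, zero_add, ← mul_assoc, mul_add, map_add,
      Algebra.TensorProduct.tmul_mul_tmul, mul_one] at h1 h2 ⊢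
    rw [h1, h2, add_zero]

/-- `τ(J d q m₁ ⋯ q mₙ)` is a limit of traces `τ(a d q m₁ ⋯ q mₙ)` with `a ∈ Alg(X, B)`, which are
zero by freeness. -/
theorem TailWord.traceMul_eq_zero {C : Subalgebra ℂ A}
    (hfree : FreelyIndependent τ ![algGen X B, C]) (hqC : q ∈ C) (hq0 : τ q = 0)
    {t : A × (A ⊗[ℂ] A)} (ht : TailWord τ X B q t) {d : A} (hd : d ∈ algGen X B) {J : L2 τ}
    (hJ : J ∈ l2Closure τ (algGen X B)) : traceMul τ J (d * t.1) = 0 := by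
  have hcl : IsClosed {ξ : L2 τ | traceMul τ ξ (d * t.1) = 0} :=
    isClosed_eq (continuous_const.inner continuous_id) continuous_const
  refine closure_minimal ?_ hcl hJ
  rintro _ ⟨a, ha, rfl⟩
  change traceMul τ (toL2 τ a) _ = 0
  rw [traceMul_toL2, ← mul_assoc]
  exact ht.trace_mul_of_mem hfree hqC hq0 (mul_mem ha hd)

theorem traceMul_add_right (τ : TracialState A) (ξ : L2 τ) (a b : A) :
    traceMul τ ξ (a + b) = traceMul τ ξ a + traceMul τ ξ b := by
  simp [traceMul, inner_add_left]

theorem traceMul_smul_right (τ : TracialState A) (ξ : L2 τ) (c : ℂ) (a : A) :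
    traceMul τ ξ (c • a) = c * traceMul τ ξ a := by
  simp [traceMul, inner_smul_left]

/-- The free score relative to `B` still computes `(τ ⊗ τ) ∘ ∂` after a free element `p` has been
added to the coefficients, provided that its shift `q = p - c` is centred and satisfies a quadratic
equation. -/
theorem IsFreeScore.traceMul_of_free {C : Subalgebra ℂ A}
    (hfree : FreelyIndependent τ ![algGen X B, C]) (hqC : q ∈ C) (hq0 : τ q = 0)
    {α β c : ℂ} (hq : q * q = α • q + β • 1) {p : A} (hp : p = q + c • 1) {J : L2 τ}
    (hJ : IsFreeScore τ X B J) {x : A × (A ⊗[ℂ] A)}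
    (hx : DiffPair X (insert p (B : Set A)) x) :
    traceMul τ J x.1 = tensorTrace τ x.2 := by
  subst hp
  have hx' : x ∈ wordSpan τ X B q := hx.mem_wordSpan_of_insert hq
  clear hx
  induction hx' using Submodule.span_induction with
  | mem w hw =>
    rcases hw with hw | ⟨m, t, hm, ht, rfl⟩
    · obtain ⟨P, rfl⟩ := hw.exists_poly
      exact hJ.2 P
    · have h1 := tensorTrace_mul_eq_zero τ hm.mem_tensorSpan (u := 1) (v := t.1)
        (Or.inr fun b hb => ht.trace_mul_of_mem hfree hqC hq0 hb)
      rw [← Algebra.TensorProduct.one_def, one_mul] at h1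
      have h2 : tensorTrace τ ((m.1 ⊗ₜ[ℂ] 1) * t.2) = 0 :=
        eq_zero_of_isCenteredWord (τ := τ) (C := C)
          (tensorTrace τ ∘ₗ LinearMap.mulRight ℂ t.2 ∘ₗ (TensorProduct.mk ℂ A A).flip 1)
          (fun u hu => ht.tensorTrace_mul hfree hqC hq0 u hu) hm.mem_algGen
      rw [pairMul_apply, ht.traceMul_eq_zero hfree hqC hq0 hm.mem_algGen hJ.1, map_add, h1, h2,
        add_zero]
  | zero => simp [traceMul]
  | add v w _ _ hv hw =>
    rw [Prod.fst_add, Prod.snd_add, traceMul_add_right, map_add, hv, hw]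
  | smul a w _ hw =>
    rw [Prod.smul_fst, Prod.smul_snd, traceMul_smul_right, map_smul, hw, smul_eq_mul]

end Words

/-! ### Conditional expectations and uniqueness of the free score -/

section Projection

variable {A : Type*} [Ring A] [StarRing A] [Algebra ℂ A] [StarModule ℂ A]

theorem star_mem_adjoin_of_star_mem {s : Set A} (hs : ∀ x ∈ s, star x ∈ s) {y : A}
    (hy : y ∈ Algebra.adjoin ℂ s) : star y ∈ Algebra.adjoin ℂ s := by
  induction hy using Algebra.adjoin_induction with
  | mem x hx => exact Algebra.subset_adjoin (hs x hx)
  | algebraMap r =>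
    rw [← algebraMap_star_comm]
    exact Subalgebra.algebraMap_mem _ _
  | add x y _ _ hx hy => rw [star_add]; exact add_mem hx hy
  | mul x y _ _ hx hy => rw [star_mul]; exact mul_mem hy hx

theorem star_mem_algGen {X : A} (hX : IsSelfAdjoint X) {B : Subalgebra ℂ A}
    (hB : ∀ b ∈ B, star b ∈ B) {y : A} (hy : y ∈ algGen X B) : star y ∈ algGen X B := by
  refine star_mem_adjoin_of_star_mem ?_ hy
  rintro x (rfl | hx)
  · exact Or.inl hX.star_eq
  · exact Or.inr (hB x hx)

theorem evalPoly_mem_algGen (X : A) (B : Subalgebra ℂ A) (P : NCPoly B) :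
    evalPoly X B P ∈ algGen X B := by
  induction P using FreeAlgebra.induction with
  | grade0 r => rw [AlgHom.commutes]; exact Subalgebra.algebraMap_mem _ _
  | grade1 o =>
    rw [evalPoly, FreeAlgebra.lift_ι_apply]
    rcases o with _ | y
    · exact Algebra.subset_adjoin (Or.inl rfl)
    · exact Algebra.subset_adjoin (Or.inr y.2)
  | mul P Q hP hQ => rw [map_mul]; exact mul_mem hP hQ
  | add P Q hP hQ => rw [map_add]; exact add_mem hP hQ

theorem exists_evalPoly_eq {X : A} {B : Subalgebra ℂ A} {y : A} (hy : y ∈ algGen X B) :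
    ∃ P : NCPoly B, evalPoly X B P = y := by
  have h : algGen X B ≤ (evalPoly X B).range := by
    refine Algebra.adjoin_le ?_
    rintro x (rfl | hx)
    · exact ⟨FreeAlgebra.ι ℂ none, by simp [evalPoly]⟩
    · exact ⟨FreeAlgebra.ι ℂ (some ⟨x, hx⟩), by simp [evalPoly]⟩
  exact h hy

theorem toL2_mem_l2Closure (τ : TracialState A) {S : Subalgebra ℂ A} {a : A} (ha : a ∈ S) :
    toL2 τ a ∈ l2Closure τ S :=
  Submodule.le_topologicalClosure _ ⟨a, ha, rfl⟩

theorem traceMul_condExp (τ : TracialState A) {S : Subalgebra ℂ A} (ξ : L2 τ) {a : A}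
    (ha : star a ∈ S) : traceMul τ (condExp τ S ξ) a = traceMul τ ξ a := by
  rw [traceMul, condExp, ← Submodule.inner_starProjection_left_eq_right,
    Submodule.starProjection_eq_self_iff.mpr (toL2_mem_l2Closure τ ha), traceMul]

theorem traceMul_smul_left (τ : TracialState A) (ξ : L2 τ) (c : ℂ) (a : A) :
    traceMul τ (c • ξ) a = c * traceMul τ ξ a := by
  rw [traceMul, inner_smul_right, traceMul]

theorem IsFreeScore.unique {τ : TracialState A} {X : A} {B : Subalgebra ℂ A}
    (hstar : ∀ y ∈ algGen X B, star y ∈ algGen X B) {J J' : L2 τ} (hJ : IsFreeScore τ X B J)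
    (hJ' : IsFreeScore τ X B J') : J = J' := by
  have hcl : IsClosed {ξ : L2 τ | inner ℂ ξ (J - J') = 0} :=
    isClosed_eq (continuous_id.inner continuous_const) continuous_const
  have h : J - J' ∈ {ξ : L2 τ | inner ℂ ξ (J - J') = 0} := by
    refine closure_minimal ?_ hcl (sub_mem hJ.1 hJ'.1)
    rintro _ ⟨a, ha, rfl⟩
    obtain ⟨P, hP⟩ := exists_evalPoly_eq (hstar a ha)
    have h1 := (hJ.2 P).trans (hJ'.2 P).symm
    rw [hP, traceMul, traceMul, star_star] at h1
    change inner ℂ (toL2 τ a) (J - J') = 0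
    rw [inner_sub_right, h1, sub_self]
  exact sub_eq_zero.mp (inner_self_eq_zero.mp h)

end Projection

/-! ### Compression by a projection -/

section Compression

variable {A : Type*} [Ring A] [StarRing A] [Algebra ℂ A] [StarModule ℂ A]
variable {p : A} (hp : IsStarProjection p)

/-- The inclusion of `A_p ⊗ A_p` into `A ⊗ A`. -/
def valTensor : Compressed hp ⊗[ℂ] Compressed hp →ₗ[ℂ] A ⊗[ℂ] A :=
  let v : Compressed hp →ₗ[ℂ] A :=
    { toFun := Compressed.val
      map_add' := Compressed.val_add
      map_smul' := Compressed.val_smul }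
  TensorProduct.map v v

theorem valTensor_tmul (x y : Compressed hp) :
    valTensor hp (x ⊗ₜ[ℂ] y) = x.val ⊗ₜ[ℂ] y.val := rfl

theorem valTensor_tmul_one_mul (x : Compressed hp) (δ : Compressed hp ⊗[ℂ] Compressed hp) :
    valTensor hp ((x ⊗ₜ[ℂ] 1) * δ) = (x.val ⊗ₜ[ℂ] 1) * valTensor hp δ := by
  induction δ using TensorProduct.induction_on with
  | zero => simp
  | tmul a b => simp [valTensor_tmul]
  | add a b ha hb => simp only [mul_add, map_add, ha, hb]

theorem valTensor_mul_one_tmul (x : Compressed hp) (δ : Compressed hp ⊗[ℂ] Compressed hp) :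
    valTensor hp (δ * (1 ⊗ₜ[ℂ] x)) = valTensor hp δ * (1 ⊗ₜ[ℂ] x.val) := by
  induction δ using TensorProduct.induction_on with
  | zero => simp
  | tmul a b => simp [valTensor_tmul]
  | add a b ha hb => simp only [add_mul, map_add, ha, hb]

theorem diffPair_val_of_mem_adjoin {X : A} {B : StarSubalgebra ℂ A} {y : Compressed hp}
    (hy : y ∈ Algebra.adjoin ℂ (minor hp '' (B : Set A))) :
    DiffPair X (insert p (B : Set A)) (y.val, 0) := by
  have hmul : ∀ a b : A, DiffPair X (insert p (B : Set A)) (a, 0) →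
      DiffPair X (insert p (B : Set A)) (b, 0) → DiffPair X (insert p (B : Set A)) (a * b, 0) := by
    intro a b ha hb
    simpa [pairMul_apply] using ha.mul hb
  have hpp : DiffPair X (insert p (B : Set A)) (p, 0) := .coeff (Or.inl rfl)
  induction hy using Algebra.adjoin_induction with
  | mem x hx =>
    obtain ⟨b, hb, rfl⟩ := hx
    exact hmul _ _ (hmul _ _ hpp (.coeff (Or.inr hb))) hpp
  | algebraMap r =>
    have hB : ∀ c : ℂ, algebraMap ℂ A c ∈ insert p (B : Set A) := fun c =>
      Or.inr (algebraMap_mem B c)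
    have := hpp.smul hB r
    simpa [Algebra.algebraMap_eq_smul_one] using this
  | add x y _ _ hx hy => simpa using hx.add hy
  | mul x y _ _ hx hy => exact hmul _ _ hx hy

/-- The free difference quotient of `A_p` with respect to `π(X)` is computed by the Leibniz rule in
`A` with `∂p = 0`, since then `∂(p X p) = p ⊗ p` is the unit of `A_p ⊗ A_p`. -/
theorem diffPair_val_diffQuot (X : A) (B : StarSubalgebra ℂ A)
    (Q : NCPoly (Algebra.adjoin ℂ (minor hp '' (B : Set A)))) :
    DiffPair X (insert p (B : Set A)) ((evalPoly (minor hp X) _ Q).val,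
      valTensor hp (diffQuot (minor hp X) _ Q)) := by
  induction Q using FreeAlgebra.induction with
  | grade0 r =>
    have h : diffQuot (minor hp X) (Algebra.adjoin ℂ (minor hp '' (B : Set A)))
        (algebraMap ℂ _ r) = 0 := by
      simp [diffQuot, Algebra.algebraMap_eq_smul_one]
    rw [h, map_zero, AlgHom.commutes]
    exact diffPair_val_of_mem_adjoin hp (Subalgebra.algebraMap_mem _ r)
  | grade1 o =>
    rcases o with _ | y
    · have hpp : DiffPair X (insert p (B : Set A)) (p, 0) := .coeff (Or.inl rfl)
      have := (hpp.mul .var).mul hpp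
      simpa [pairMul_apply, diffQuot_var, valTensor_tmul, evalPoly, minor_val] using this
    · have := diffPair_val_of_mem_adjoin hp (X := X) y.2
      simpa [diffQuot_coeff, evalPoly] using this
  | mul P Q hP hQ =>
    have := hP.mul hQ
    rwa [pairMul_apply, ← valTensor_mul_one_tmul, ← valTensor_tmul_one_mul, ← map_add,
      ← Compressed.val_mul, ← map_mul, add_comm, ← diffQuot_mul] at this
  | add P Q hP hQ => simpa using hP.add hQ

theorem tensorTrace_compressedTrace (τ : TracialState A) {k : ℝ} (hk : 1 ≤ k)
    (hτp : τ p = ((k⁻¹ : ℝ) : ℂ)) (δ : Compressed hp ⊗[ℂ] Compressed hp) :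
    tensorTrace (compressedTrace τ hp hk hτp) δ = k * (k * tensorTrace τ (valTensor hp δ)) := by
  induction δ using TensorProduct.induction_on with
  | zero => simp
  | tmul a b =>
    simp only [tensorTrace_tmul, valTensor_tmul, compressedTrace_apply]
    ring
  | add a b ha hb => simp only [map_add, ha, hb]; ring

/-- As `y = p y p`, the compression of `ξ` is not seen by the pairing with `y`, apart from the
normalization of the trace. -/
theorem traceMul_minorL2 (τ : TracialState A) {k : ℝ} (hk : 1 ≤ k)
    (hτp : τ p = ((k⁻¹ : ℝ) : ℂ)) (ξ : L2 τ) (y : Compressed hp) :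
    traceMul (compressedTrace τ hp hk hτp) (minorL2 τ hp hk hτp ξ) y =
      k * traceMul τ ξ y.val := by
  induction ξ using UniformSpace.Completion.induction_on with
  | hp =>
    exact isClosed_eq (continuous_const.inner (minorL2 τ hp hk hτp).continuous)
      (continuous_const.mul (continuous_const.inner continuous_id))
  | ih a =>
    obtain ⟨a, rfl⟩ := (toPreL2 τ).surjective a
    change traceMul _ (minorL2 τ hp hk hτp (toL2 τ a)) y = k * traceMul τ (toL2 τ a) y.val
    rw [minorL2_toL2, traceMul_toL2, traceMul_toL2, compressedTrace_apply, Compressed.val_mul,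
      minor_val, mul_assoc, y.p_mul, mul_assoc, τ.map_mul_comm, mul_assoc, y.mul_p,
      τ.map_mul_comm]

end Compression

end

end FreeProb

open FreeProb
theorem proposition2p3 {A : Type*} [Ring A] [StarRing A] [Algebra ℂ A] [StarModule ℂ A]
    (τ : TracialState A) (k : ℝ) (hk : 1 ≤ k)
    (p : A) (hp : IsStarProjection p) (hτp : τ p = ((k⁻¹ : ℝ) : ℂ))
    (X : A) (hX : IsSelfAdjoint X) (B : StarSubalgebra ℂ A)
    (hfree : FreelyIndependent τ ![algGen X B.toSubalgebra, Algebra.adjoin ℂ {p}])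
    (J : L2 τ) (hJ : IsFreeScore τ X B.toSubalgebra J) :
    let τp : TracialState (Compressed hp) := compressedTrace τ hp hk hτp
    let πB : Subalgebra ℂ (Compressed hp) := Algebra.adjoin ℂ (minor hp '' (B : Set A))
    let Jp : L2 τp := (k : ℂ) • condExp τp (algGen (minor hp X) πB) (minorL2 τ hp hk hτp J)
    IsFreeScore τp (minor hp X) πB Jp ∧
      ∀ J' : L2 τp, IsFreeScore τp (minor hp X) πB J' → J' = Jp := by
  intro τp πB Jp
  have hπstar : ∀ a : A, star (minor hp a) = minor hp (star a) := fun a =>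
    Compressed.ext (by simp [minor_val, hp.isSelfAdjoint.star_eq, mul_assoc])
  have hstar : ∀ y ∈ algGen (minor hp X) πB, star y ∈ algGen (minor hp X) πB := by
    refine fun y hy => star_mem_algGen ?_ ?_ hy
    · rw [IsSelfAdjoint, hπstar, hX.star_eq]
    · intro b hb
      refine star_mem_adjoin_of_star_mem ?_ hb
      rintro _ ⟨a, ha, rfl⟩
      exact ⟨star a, star_mem ha, (hπstar a).symm⟩
  have hq : (p - ((k⁻¹ : ℝ) : ℂ) • (1 : A)) * (p - ((k⁻¹ : ℝ) : ℂ) • (1 : A)) =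
      (1 - 2 * ((k⁻¹ : ℝ) : ℂ)) • (p - ((k⁻¹ : ℝ) : ℂ) • (1 : A)) +
        (((k⁻¹ : ℝ) : ℂ) - ((k⁻¹ : ℝ) : ℂ) ^ 2) • (1 : A) := by
    simp only [mul_sub, sub_mul, hp.isIdempotentElem.eq, smul_mul_assoc, mul_smul_comm, mul_one,
      one_mul]
    module
  have hscore : IsFreeScore τp (minor hp X) πB Jp := by
    refine ⟨Submodule.smul_mem _ _ (Submodule.starProjection_apply_mem _ _), fun Q => ?_⟩
    have hQ := diffPair_val_diffQuot hp X B Q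
    have hp' : p ∈ Algebra.adjoin ℂ {p} := Algebra.self_mem_adjoin_singleton ℂ p
    have key := hJ.traceMul_of_free hfree
      (sub_mem hp' (Subalgebra.smul_mem _ (one_mem _) _)) (by simp [hτp, τ.map_one]) hq
      (sub_add_cancel _ _).symm hQ
    -- the factor `k` of `Jp` and the one of `τ_p` on the left match the two of `τ_p ⊗ τ_p`
    rw [traceMul_smul_left, traceMul_condExp _ _ (hstar _ (evalPoly_mem_algGen _ _ Q)),
      traceMul_minorL2, key, tensorTrace_compressedTrace]
  exact ⟨hscore, fun J' hJ' => hJ'.unique hstar hscore⟩
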